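/- Let $A,B\in\mathbb{Q}$ with $AB\neq 0$. Suppose that $x^4+Ax+B$ has a rational root $r$, and that the polynomial $(x^{12}+Ax^3+B)/(x^3-r)\in\mathbb{Q}[x]$ has a factor of degree $3$ in $\mathbb{Q}[x]$ (not necessarily irreducible). Then one of the following holds. (1) There is $w\in\mathbb{Q}$ with $rw(r-w)\neq 0$ and $$(A,B)=\bigl(-(r-w)(r^2+w^2),\,-rw(r^2-rw+w^2)\bigr),$$ with factorization $$x^{12}+Ax^3+B=(x^3-r)(x^3+w)\bigl(x^6+(r-w)x^3+r^2-rw+w^2\bigr).$$ (2) Up to scaling, $(A,B)$ is $(128,256)$ or $(-5616,-3888)$; that is, for some $\lambda\in\mathbb{Q}\setminus\{0\}$, $(A,B)=(128\lambda^9,256\lambda^{12})$ or $(A,B)=(-5616\lambda^9,-3888\lambda^{12})$. Moreover, $$x^{12}+128x^3+256=(x^3+4)(x^3+2x^2+4x+4)(x^6-2x^5+8x^2-16x+16),$$ $$x^{12}-5616x^3-3888=(x^3-18)(x^3+6x+6)(x^6-6x^4+12x^3+36x^2-36x+36).$$ -/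

import Mathlib

open Polynomial

/-- The trinomial `x ^ n + A x ^ m + B` over the rationals. -/
noncomputable def ratTrinomial (n m : ℕ) (A B : ℚ) : ℚ[X] :=
  X ^ n + C A * X ^ m + C B

/-- The trinomials `x ^ n + A x ^ m + B` and `x ^ n + A' x ^ m + B'` agree up to scaling:
`(A, B) = (A' l ^ (n - m), B' l ^ n)` for some nonzero rational `l`.
(Used with `m ≤ n` only.) -/
def EqUpToScaling (n m : ℕ) (A B A' B' : ℚ) : Prop :=
  ∃ l : ℚ, l ≠ 0 ∧ A = A' * l ^ (n - m) ∧ B = B' * l ^ n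

/-! Dividing by `x^3 - r` leaves `h(x^3)` with `h(t) = t^3 + r t^2 + r^2 t + (r^3 + A)`. A rational
root `-w` of `h` gives (1). Otherwise `h` is irreducible, and a root `α` of the cubic factor makes
`h` the characteristic polynomial of `α^3` (`coeffs_eq_of_cube_root`). Its middle coefficients are
`r` and `r^2`, so the coefficients of the monic factor lie on the weighted curve `u^2 = v`, solved
in `cubic_coeffs`.

For `a = 0` the curve has an evident parametrization. For `a ≠ 0` it maps to `2(x+y+z)^3 = 81xyz`,
whose rational points all have `x+y+z = 0`. This is proved by infinite descent: a primitive solution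
yields `18a^3 + b^3 + c^3 = 9abc`, which factors as a linear form times an Eisenstein norm. Both are
cubes, and unique factorization in `ℤ[ω]` returns a smaller solution. -/

theorem Int.isCoprime_of_forall_prime {x y : ℤ}
    (h : ∀ p : ℤ, Prime p → p ∣ x → p ∣ y → False) : IsCoprime x y := by
  rw [Int.isCoprime_iff_gcd_eq_one]
  by_contra hne
  obtain ⟨p, hp, hpd⟩ := Nat.exists_prime_and_dvd hne
  exact h p (Nat.prime_iff_prime_int.mp hp)
    ((Int.natCast_dvd_natCast.mpr hpd).trans (Int.gcd_dvd_left _ _))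
    ((Int.natCast_dvd_natCast.mpr hpd).trans (Int.gcd_dvd_right _ _))

theorem Int.prime_dvd_three {p : ℤ} (hp : Prime p) (h : p ∣ 3) : 3 ∣ p :=
  ((hp.associated_of_dvd Int.prime_three h).symm).dvd

/-! ### Eisenstein integers: Euclidean division and norms that are cubes. -/

/-- The Eisenstein integers `ℤ[ω]`, where `ω ^ 2 = -1 - ω`. -/
abbrev EisensteinInt : Type := QuadraticAlgebra ℤ (-1) (-1)

namespace EisensteinInt

theorem norm_eq (z : EisensteinInt) : z.norm = z.re ^ 2 - z.re * z.im + z.im ^ 2 := by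
  rw [QuadraticAlgebra.norm_def]; ring

theorem norm_nonneg (z : EisensteinInt) : 0 ≤ z.norm := by
  rw [norm_eq]; nlinarith [sq_nonneg (z.re - z.im), sq_nonneg z.re, sq_nonneg z.im]

theorem norm_eq_zero {z : EisensteinInt} : z.norm = 0 ↔ z = 0 := by
  refine ⟨fun h => ?_, fun h => by simp [h]⟩
  rw [norm_eq] at h
  have hre : z.re = 0 := by
    by_contra h0
    have := pow_pos (abs_pos.mpr h0) 2
    rw [sq_abs] at this
    nlinarith [sq_nonneg (z.re - 2 * z.im)]
  have him : z.im = 0 := by simpa [hre] using h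
  ext <;> simp [hre, him]

theorem norm_pos {z : EisensteinInt} (hz : z ≠ 0) : 0 < z.norm :=
  (norm_nonneg z).lt_of_ne fun h => hz (norm_eq_zero.mp h.symm)

instance : NoZeroDivisors EisensteinInt where
  eq_zero_or_eq_zero_of_mul_eq_zero {x y} h := by
    have := congrArg QuadraticAlgebra.norm h
    rw [map_mul, QuadraticAlgebra.norm_zero, mul_eq_zero] at this
    exact this.imp norm_eq_zero.mp norm_eq_zero.mp

/-- An integer nearest to the quotient of two integers. -/
def nearestDiv (m n : ℤ) : ℤ := (2 * m + n) / (2 * n)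

theorem nearestDiv_bounds (m : ℤ) {n : ℤ} (hn : 0 < n) :
    -n ≤ 2 * (m - n * nearestDiv m n) ∧ 2 * (m - n * nearestDiv m n) ≤ n := by
  have h1 := Int.mul_ediv_add_emod (2 * m + n) (2 * n)
  have h2 := Int.emod_nonneg (2 * m + n) (show 2 * n ≠ 0 by omega)
  have h3 := Int.emod_lt_of_pos (2 * m + n) (show 0 < 2 * n by omega)
  unfold nearestDiv
  constructor <;> linarith

/-- Division of Eisenstein integers, rounding both coordinates of the exact quotient. -/
def quot (x y : EisensteinInt) : EisensteinInt :=
  ⟨nearestDiv (x * star y).re y.norm, nearestDiv (x * star y).im y.norm⟩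

/-- Rounding errors `e, f` are at most `N/2` in size, so `e^2 - ef + f^2 ≤ 3N^2/4 < N^2`. -/
theorem norm_sub_mul_quot_lt (x : EisensteinInt) {y : EisensteinInt} (hy : y ≠ 0) :
    (x - y * quot x y).norm < y.norm := by
  have hN := norm_pos hy
  obtain ⟨h1, h2⟩ := nearestDiv_bounds (x * star y).re hN
  obtain ⟨h3, h4⟩ := nearestDiv_bounds (x * star y).im hN
  have key : (x - y * quot x y).norm * y.norm =
      ((x * star y).re - y.norm * nearestDiv (x * star y).re y.norm) ^ 2 -
      ((x * star y).re - y.norm * nearestDiv (x * star y).re y.norm) *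
      ((x * star y).im - y.norm * nearestDiv (x * star y).im y.norm) +
      ((x * star y).im - y.norm * nearestDiv (x * star y).im y.norm) ^ 2 := by
    rw [← QuadraticAlgebra.norm_star y, ← map_mul, norm_eq]
    have : (x - y * quot x y) * star y = x * star y - algebraMap ℤ _ y.norm * quot x y := by
      rw [QuadraticAlgebra.algebraMap_norm_eq_mul_star]; ring
    rw [this]
    simp [quot]
  generalize (x * star y).re - y.norm * nearestDiv (x * star y).re y.norm = e at *
  generalize (x * star y).im - y.norm * nearestDiv (x * star y).im y.norm = f at *
  generalize y.norm = N at *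
  nlinarith

instance : EuclideanDomain EisensteinInt where
  quotient := quot
  remainder x y := x - y * quot x y
  quotient_zero x := by ext <;> simp [quot, nearestDiv]
  quotient_mul_add_remainder_eq x y := by simp
  r := InvImage (· < ·) fun z => z.norm.natAbs
  r_wellFounded := InvImage.wf _ Nat.lt_wfRel.wf
  remainder_lt x y hy := by
    have h1 := norm_sub_mul_quot_lt x hy
    have h2 := norm_nonneg (x - y * quot x y)
    change Int.natAbs _ < Int.natAbs _
    omega
  mul_left_not_lt x y hy := by
    have h1 := norm_nonneg x
    have h2 := norm_pos hy
    change ¬ Int.natAbs _ < Int.natAbs _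
    rw [map_mul, Int.natAbs_mul, not_lt]
    exact Nat.le_mul_of_pos_right _ (by omega)

/-- The six units of the Eisenstein integers. -/
theorem eq_of_isUnit {z : EisensteinInt} (hz : IsUnit z) :
    ∃ s : EisensteinInt, (s = 1 ∨ s = -1) ∧ (z = s ∨ z = s * ⟨0, 1⟩ ∨ z = s * ⟨-1, -1⟩) := by
  rw [QuadraticAlgebra.isUnit_iff_norm_isUnit, Int.isUnit_iff] at hz
  have h1 : z.norm = 1 := hz.resolve_right (by have := norm_nonneg z; omega)
  rw [norm_eq] at h1
  have hre : -1 ≤ z.re ∧ z.re ≤ 1 := by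
    constructor <;> nlinarith [sq_nonneg (z.re - 2 * z.im)]
  have him : -1 ≤ z.im ∧ z.im ≤ 1 := by
    constructor <;> nlinarith [sq_nonneg (2 * z.re - z.im)]
  obtain ⟨x, y⟩ := z
  obtain ⟨hx1, hx2⟩ := hre
  obtain ⟨hy1, hy2⟩ := him
  dsimp only at *
  clear hz
  interval_cases x <;> interval_cases y <;>
    first
    | (norm_num at h1; done)
    | exact ⟨1, Or.inl rfl, by decide⟩
    | exact ⟨-1, Or.inr rfl, by decide⟩

theorem cube_re_im (p q : ℤ) : (⟨p, q⟩ : EisensteinInt) ^ 3 =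
    ⟨p ^ 3 + q ^ 3 - 3 * p * q ^ 2, 3 * p * q * (p - q)⟩ := by
  ext <;> simp [pow_succ] <;> ring

/-- A Bézout relation between the trace `2u - v` and the norm is also one between the element and
its conjugate. -/
theorem isCoprime_star {u v : ℤ} (huv : IsCoprime u v) (h3 : ¬ 3 ∣ u ^ 2 - u * v + v ^ 2) :
    IsCoprime (⟨u, v⟩ : EisensteinInt) (star ⟨u, v⟩) := by
  have hT : IsCoprime (2 * u - v) (u ^ 2 - u * v + v ^ 2) := by
    refine Int.isCoprime_of_forall_prime fun p hp' h1 h2 => ?_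
    have h4 : p ∣ 3 * u ^ 2 := by
      have : 3 * u ^ 2 = (u ^ 2 - u * v + v ^ 2) + (2 * u - v) * (u + v) := by ring
      rw [this]; exact dvd_add h2 (h1.mul_right _)
    have hu : p ∣ u := by
      rcases hp'.dvd_or_dvd h4 with h5 | h5
      · exact absurd ((Int.prime_dvd_three hp' h5).trans h2) h3
      · exact hp'.dvd_of_dvd_pow h5
    have hv : p ∣ v := by
      have : v = 2 * u - (2 * u - v) := by ring
      rw [this]; exact dvd_sub (hu.mul_left _) h1
    exact hp'.not_isUnit (huv.isUnit_of_dvd' hu hv)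
  obtain ⟨s, t, hst⟩ := hT
  refine ⟨⟨s, 0⟩ + ⟨t, 0⟩ * star ⟨u, v⟩, ⟨s, 0⟩, ?_⟩
  ext
  · simp [QuadraticAlgebra.re_one]; linear_combination hst
  · simp [QuadraticAlgebra.im_one]; ring

/-- A primitive Eisenstein integer whose norm is a cube prime to `3` is a cube up to a unit. -/
theorem eq_cube_of_norm_eq_cube {u v n : ℤ} (huv : IsCoprime u v) (h3 : ¬ 3 ∣ n)
    (hn : u ^ 2 - u * v + v ^ 2 = n ^ 3) :
    ∃ p q : ℤ, n = p ^ 2 - p * q + q ^ 2 ∧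
      (v = 3 * p * q * (p - q) ∨ v = p ^ 3 + q ^ 3 - 3 * p ^ 2 * q ∨
        v = -(p ^ 3 + q ^ 3 - 3 * p * q ^ 2)) := by
  have hc := isCoprime_star huv
    (hn ▸ fun h => h3 (Int.prime_three.dvd_of_dvd_pow h))
  have hmul : (⟨u, v⟩ : EisensteinInt) * star ⟨u, v⟩ = (⟨n, 0⟩ : EisensteinInt) ^ 3 := by
    rw [← QuadraticAlgebra.algebraMap_norm_eq_mul_star, norm_eq, cube_re_im,
      QuadraticAlgebra.algebraMap_eq]
    ext <;> simp [hn]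
  obtain ⟨d, e, he⟩ := exists_associated_pow_of_mul_eq_pow' hc hmul
  obtain ⟨s, hs, hcase⟩ := eq_of_isUnit e.isUnit
  -- The sign `s` equals `s^3`, so it is absorbed into the cube; only the unit `1`, `ω` or `ω^2`
  -- remains.
  obtain ⟨p, q, hpq⟩ : ∃ p q : ℤ, s * d = ⟨p, q⟩ := ⟨_, _, rfl⟩
  have hs3 : d ^ 3 * s = ⟨p, q⟩ ^ 3 := by
    rw [← hpq]; rcases hs with rfl | rfl <;> ring
  have hcube : ∃ t : EisensteinInt, (t = 1 ∨ t = ⟨0, 1⟩ ∨ t = ⟨-1, -1⟩) ∧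
      ⟨u, v⟩ = (⟨p, q⟩ : EisensteinInt) ^ 3 * t := by
    rcases hcase with h | h | h
    · exact ⟨1, by simp, by rw [← he, h, hs3, mul_one]⟩
    · exact ⟨_, Or.inr (Or.inl rfl), by rw [← he, h, ← mul_assoc, hs3]⟩
    · exact ⟨_, Or.inr (Or.inr rfl), by rw [← he, h, ← mul_assoc, hs3]⟩
  obtain ⟨t, ht, huvt⟩ := hcube
  have hnorm := congrArg QuadraticAlgebra.norm huvt
  have htn : t.norm = 1 := by rcases ht with rfl | rfl | rfl <;> simp [norm_eq]
  rw [map_mul, map_pow, htn, mul_one, norm_eq, norm_eq, hn] at hnorm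
  refine ⟨p, q, (Odd.strictMono_pow (by decide : Odd 3)).injective hnorm, ?_⟩
  rw [cube_re_im] at huvt
  have him := congrArg QuadraticAlgebra.im huvt
  rcases ht with rfl | rfl | rfl
  · left; simpa using him
  · right; left; simp at him; linear_combination him
  · right; right; simp at him; linear_combination him

end EisensteinInt

/-! ### Descent on `2(x+y+z)^3 = 81xyz`. -/

theorem Int.eq_cube_of_mul_mul_eq_cube {x y z t : ℤ} (hxy : IsCoprime x y) (hxz : IsCoprime x z)
    (hyz : IsCoprime y z) (h : x * y * z = t ^ 3) :
    ∃ a b c : ℤ, x = a ^ 3 ∧ y = b ^ 3 ∧ z = c ^ 3 ∧ a * b * c = t := by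
  have h3 : Odd 3 := by decide
  obtain ⟨⟨d, hd⟩, ⟨c, hc⟩⟩ := Int.eq_pow_of_mul_eq_pow_odd (hxz.mul_left hyz) h3 h
  obtain ⟨⟨a, ha⟩, ⟨b, hb⟩⟩ := Int.eq_pow_of_mul_eq_pow_odd hxy h3 hd
  refine ⟨a, b, c, ha, hb, hc, (h3.strictMono_pow).injective ?_⟩
  rw [ha, hb, hc] at h
  linear_combination h

theorem not_cubic_form_one {f p q : ℤ} (h3 : ¬ 3 ∣ p ^ 2 - p * q + q ^ 2) :
    f ^ 3 - 3 * f * (p ^ 2 - p * q + q ^ 2) ≠ p ^ 3 + q ^ 3 - 3 * p ^ 2 * q := by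
  intro h
  have hZ : ∀ f p q : ZMod 9,
      f ^ 3 - 3 * f * (p ^ 2 - p * q + q ^ 2) = p ^ 3 + q ^ 3 - 3 * p ^ 2 * q →
      3 * (p ^ 2 - p * q + q ^ 2) = 0 := by decide +kernel
  have h9 := hZ f p q (by exact_mod_cast congrArg (Int.cast : ℤ → ZMod 9) h)
  have h9' : ((3 * (p ^ 2 - p * q + q ^ 2) : ℤ) : ZMod 9) = 0 := by exact_mod_cast h9
  rw [ZMod.intCast_zmod_eq_zero_iff_dvd] at h9'
  omega

theorem not_cubic_form_two {f p q : ℤ} (h3 : ¬ 3 ∣ p ^ 2 - p * q + q ^ 2) :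
    f ^ 3 - 3 * f * (p ^ 2 - p * q + q ^ 2) ≠ -(p ^ 3 + q ^ 3 - 3 * p * q ^ 2) := by
  have h3' : ¬ 3 ∣ (-q) ^ 2 - (-q) * (-p) + (-p) ^ 2 := by
    rwa [show (-q) ^ 2 - (-q) * (-p) + (-p) ^ 2 = p ^ 2 - p * q + q ^ 2 by ring]
  intro h
  -- The substitution `(p, q) ↦ (-q, -p)` exchanges the two forms.
  exact not_cubic_form_one h3' (f := f) (by linear_combination h)

/-- A descent step on `18 a³ + b³ + c³ = 9 a b c`. -/
theorem exists_of_cubic_eq {a b c : ℤ} (hab : IsCoprime a b) (h3 : ¬ 3 ∣ b)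
    (h : 18 * a ^ 3 + b ^ 3 + c ^ 3 = 9 * a * b * c) :
    ∃ f p q : ℤ, f ∣ a ∧ f ^ 3 - 3 * f * (p ^ 2 - p * q + q ^ 2) = 3 * p * q * (p - q) := by
  obtain ⟨k, hk⟩ : (3 : ℤ) ∣ b + c := by
    refine Int.prime_three.dvd_of_dvd_pow (n := 3)
      ⟨3 * a * b * c - 6 * a ^ 3 + b ^ 2 * c + b * c ^ 2, ?_⟩
    linear_combination h
  obtain rfl : c = 3 * k - b := by linarith
  -- This is `X^3 + Y^3 + Z^3 - 3XYZ` factored at `(3a, b, c)`, where it equals `9a^3`; the second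
  -- factor is the norm of `(b-a-k) + (k-2a)ω`.
  have hmul : (k + a) * ((b - a - k) ^ 2 - (b - a - k) * (k - 2 * a) + (k - 2 * a) ^ 2) = a ^ 3 := by
    linarith
  have hprime : ∀ r : ℤ, Prime r → r ∣ a → r ∣ b → False := fun r hr hra hrb =>
    hr.not_isUnit (hab.isUnit_of_dvd' hra hrb)
  have hmn : IsCoprime (k + a)
      ((b - a - k) ^ 2 - (b - a - k) * (k - 2 * a) + (k - 2 * a) ^ 2) := by
    refine Int.isCoprime_of_forall_prime fun r hr h1 h2 => ?_
    have ha : r ∣ a := hr.dvd_of_dvd_pow (hmul ▸ h1.mul_right _)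
    refine hprime r hr ha (hr.dvd_of_dvd_pow (n := 2) ?_)
    have : b ^ 2 = ((b - a - k) ^ 2 - (b - a - k) * (k - 2 * a) + (k - 2 * a) ^ 2) +
        (k + a) * (3 * b - 3 * k) + a * (6 * k - 3 * b - 3 * a) := by
      ring
    rw [this]
    exact dvd_add (dvd_add h2 (h1.mul_right _)) (ha.mul_right _)
  obtain ⟨⟨f, hf⟩, ⟨g, hg⟩⟩ := Int.eq_pow_of_mul_eq_pow_odd hmn (by decide : Odd 3) hmul
  have ha : a = f * g := by
    refine ((by decide : Odd 3).strictMono_pow).injective (?_ : a ^ 3 = (f * g) ^ 3)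
    rw [← hmul, hf, hg]; ring
  have huv : IsCoprime (b - a - k) (k - 2 * a) := by
    refine Int.isCoprime_of_forall_prime fun r hr h1 h2 => ?_
    have ha : r ∣ a := by
      refine hr.dvd_of_dvd_pow (n := 3) (hmul ▸ Dvd.dvd.mul_left ?_ _)
      exact dvd_add (dvd_sub (dvd_pow h1 two_ne_zero) (h1.mul_right _)) (dvd_pow h2 two_ne_zero)
    refine hprime r hr ha ?_
    have : b = (b - a - k) + (k - 2 * a) + 3 * a := by ring
    rw [this]
    exact dvd_add (dvd_add h1 h2) (ha.mul_left _)
  have h3g : ¬ 3 ∣ g := by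
    intro h3g
    refine h3 (Int.prime_three.dvd_of_dvd_pow (n := 2) ?_)
    have : b ^ 2 = g ^ 3 + 3 * (b * k - a ^ 2 + k * a - k ^ 2) := by
      rw [← hg]; ring
    rw [this]
    exact dvd_add (dvd_pow h3g three_ne_zero) (dvd_mul_right _ _)
  obtain ⟨p, q, rfl, hpq⟩ := EisensteinInt.eq_cube_of_norm_eq_cube huv h3g hg
  refine ⟨f, p, q, ⟨_, ha⟩, ?_⟩
  have hv : k - 2 * a = f ^ 3 - 3 * f * (p ^ 2 - p * q + q ^ 2) := by
    linear_combination hf - 3 * ha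
  rw [hv] at hpq
  rcases hpq with hpq | hpq | hpq
  · exact hpq
  · exact absurd hpq (not_cubic_form_one h3g)
  · exact absurd hpq (not_cubic_form_two h3g)

theorem Int.three_dvd_of_nine_dvd {a c : ℤ} (h : 9 ∣ 2 * a ^ 3 + c ^ 3) : 3 ∣ a ∧ 3 ∣ c := by
  have hZ : ∀ a c : ZMod 9, 2 * a ^ 3 + c ^ 3 = 0 → 3 * a = 0 ∧ 3 * c = 0 := by decide
  have h9 := (ZMod.intCast_zmod_eq_zero_iff_dvd _ 9).mpr h
  push_cast at h9
  obtain ⟨h1, h2⟩ := hZ a c h9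
  have h1' : ((3 * a : ℤ) : ZMod 9) = 0 := by exact_mod_cast h1
  have h2' : ((3 * c : ℤ) : ZMod 9) = 0 := by exact_mod_cast h2
  rw [ZMod.intCast_zmod_eq_zero_iff_dvd] at h1' h2'
  omega

theorem Int.nine_dvd_of_dvd_mul {x y z : ℤ} (hxy : IsCoprime x y) (hxz : IsCoprime x z)
    (hx : 3 ∣ x) (h : 9 ∣ x * y * z) : 9 ∣ x := by
  have h9 : IsCoprime (3 ^ 2 : ℤ) (y * z) :=
    ((hxy.of_isCoprime_of_dvd_left hx).mul_right (hxz.of_isCoprime_of_dvd_left hx)).pow_left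
  rw [mul_assoc] at h
  exact h9.dvd_of_dvd_mul_right h

/-- The equation `x y z = 9 t³`, `2 x + y + z = 9 t` forces the factor `9` to divide `x`. -/
theorem not_nine_dvd {x y z t : ℤ} (hxy : IsCoprime x (9 * y)) (hxz : IsCoprime x z)
    (hyz : IsCoprime (9 * y) z) (h : x * y * z = t ^ 3) : 2 * x + 9 * y + z ≠ 9 * t := by
  intro hs
  obtain ⟨a, b, c, rfl, rfl, rfl, rfl⟩ := Int.eq_cube_of_mul_mul_eq_cube
    (hxy.of_isCoprime_of_dvd_right (dvd_mul_left _ _)) hxz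
    (hyz.of_isCoprime_of_dvd_left (dvd_mul_left _ _)) h
  obtain ⟨ha, hc⟩ := Int.three_dvd_of_nine_dvd (a := a) (c := c) ⟨a * b * c - b ^ 3, by linarith⟩
  exact Int.prime_three.not_isUnit
    (hxz.isUnit_of_dvd' (dvd_pow ha three_ne_zero) (dvd_pow hc three_ne_zero))

theorem exists_smaller_of_even {x y z : ℤ} (hxy : IsCoprime x y) (hxz : IsCoprime x z)
    (hyz : IsCoprime y z) (h2 : 2 ∣ x) (hS : x + y + z ≠ 0)
    (h : 2 * (x + y + z) ^ 3 = 81 * (x * y * z)) :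
    ∃ x' y' z' : ℤ, x' + y' + z' ≠ 0 ∧ 2 * (x' + y' + z') ^ 3 = 81 * (x' * y' * z') ∧
      (x' + y' + z').natAbs < (x + y + z).natAbs := by
  obtain ⟨t, ht⟩ : 9 ∣ x + y + z := by
    obtain ⟨s, hs⟩ : 3 ∣ x + y + z := Int.prime_three.dvd_of_dvd_pow (n := 3) (by omega)
    rw [hs] at h
    have : 3 ∣ s := Int.prime_three.dvd_of_dvd_pow (n := 3) (by ring_nf at h; omega)
    omega
  have hprod : x * y * z = 18 * t ^ 3 := by rw [ht] at h; linarith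
  obtain ⟨x, rfl⟩ := h2
  replace hxy := hxy.of_isCoprime_of_dvd_left (dvd_mul_left x 2)
  replace hxz := hxz.of_isCoprime_of_dvd_left (dvd_mul_left x 2)
  have hprod' : x * y * z = 9 * t ^ 3 := by linarith
  have h3 : 3 ∣ x * y * z := ⟨3 * t ^ 3, by linarith⟩
  rcases Int.prime_three.dvd_or_dvd h3 with h3 | h3z
  · rcases Int.prime_three.dvd_or_dvd h3 with h3x | h3y
    · obtain ⟨x, rfl⟩ := Int.nine_dvd_of_dvd_mul hxy hxz h3x ⟨_, hprod'⟩
      have h3y : ¬ 3 ∣ y := fun h3y => Int.prime_three.not_isUnit (hxy.isUnit_of_dvd' h3x h3y)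
      replace hxy := hxy.of_isCoprime_of_dvd_left (dvd_mul_left x 9)
      replace hxz := hxz.of_isCoprime_of_dvd_left (dvd_mul_left x 9)
      obtain ⟨a, b, c, rfl, rfl, rfl, rfl⟩ := Int.eq_cube_of_mul_mul_eq_cube hxy hxz hyz
        (t := t) (by linarith)
      obtain ⟨f, p, q, ⟨n, rfl⟩, hfpq⟩ := exists_of_cubic_eq (a := a) (b := b) (c := c)
        ((IsCoprime.pow_iff (by decide) (by decide)).mp hxy)
        (fun h => h3y (dvd_pow h three_ne_zero)) (by linarith)
      have ht0 : f * n * b * c ≠ 0 := by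
        intro h0; rw [h0] at ht; exact hS (by linarith)
      have hf0 : f ≠ 0 := by rintro rfl; simp at ht0
      -- The shifts `-p, q, p - q` sum to zero, so the new sum is `3f`, a proper divisor of the old
      -- sum `9fnbc`.
      refine ⟨f - p, f + q, f + p - q, ?_, ?_, ?_⟩
      · intro h0; apply hf0; linarith
      · linear_combination (-27) * hfpq
      · rw [ht, show f - p + (f + q) + (f + p - q) = 3 * f by ring,
          show 9 * (f * n * b * c) = 3 * f * (3 * (n * b * c)) by ring, Int.natAbs_mul (3 * f)]
        have h1 : 0 < (3 * f).natAbs := Int.natAbs_pos.mpr (by omega)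
        have h2 : n * b * c ≠ 0 := by
          intro h0; apply ht0; linear_combination f * h0
        exact lt_mul_of_one_lt_right h1 (by omega)
    · obtain ⟨y, rfl⟩ := Int.nine_dvd_of_dvd_mul hxy.symm hyz h3y
        ⟨t ^ 3, by linear_combination hprod'⟩
      exact absurd ht (not_nine_dvd hxy hxz hyz (by linarith))
  · obtain ⟨z, rfl⟩ := Int.nine_dvd_of_dvd_mul hxz.symm hyz.symm h3z
      ⟨t ^ 3, by linear_combination hprod'⟩
    exact absurd (by linarith) (not_nine_dvd hxz hxy hyz.symm (t := t) (by linarith))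

/-- A prime dividing two variables divides `x+y+z`, hence the third; only `p = 2` needs separate
care because of the coefficient `2`. -/
theorem isCoprime_of_eq {x y z : ℤ} (hg : ∀ p : ℤ, Prime p → p ∣ x → p ∣ y → p ∣ z → False)
    (h : 2 * (x + y + z) ^ 3 = 81 * (x * y * z)) : IsCoprime x y := by
  refine Int.isCoprime_of_forall_prime fun p hp hx hy => hg p hp hx hy ?_
  have hS : p ∣ x + y + z := by
    have hpp : p * p ∣ 2 * (x + y + z) ^ 3 := h ▸ ((mul_dvd_mul hx hy).mul_right z).mul_left 81
    rcases hp.dvd_or_dvd ((dvd_mul_right p p).trans hpp) with h2 | h2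
    · have h2p : 2 ∣ p := ((hp.associated_of_dvd Int.prime_two h2).symm).dvd
      obtain ⟨x, rfl⟩ := h2p.trans hx
      obtain ⟨y, rfl⟩ := h2p.trans hy
      exact h2.trans (Int.prime_two.dvd_of_dvd_pow (n := 3) ⟨81 * x * y * z, by linarith⟩)
    · exact hp.dvd_of_dvd_pow h2
  have : z = x + y + z - (x + y) := by ring
  rw [this]
  exact dvd_sub hS (dvd_add hx hy)

theorem exists_smaller {x y z : ℤ} (hg : ∀ p : ℤ, Prime p → p ∣ x → p ∣ y → p ∣ z → False)
    (hS : x + y + z ≠ 0) (h : 2 * (x + y + z) ^ 3 = 81 * (x * y * z)) :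
    ∃ x' y' z' : ℤ, x' + y' + z' ≠ 0 ∧ 2 * (x' + y' + z') ^ 3 = 81 * (x' * y' * z') ∧
      (x' + y' + z').natAbs < (x + y + z).natAbs := by
  have hxy := isCoprime_of_eq hg h
  have hyz := isCoprime_of_eq (x := y) (y := z) (z := x) (fun p hp h1 h2 h3 => hg p hp h3 h1 h2)
    (by linear_combination h)
  have hzx := isCoprime_of_eq (x := z) (y := x) (z := y) (fun p hp h1 h2 h3 => hg p hp h2 h3 h1)
    (by linear_combination h)
  have h2 : 2 ∣ x * y * z := by omega
  rcases Int.prime_two.dvd_or_dvd h2 with h2 | h2z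
  · rcases Int.prime_two.dvd_or_dvd h2 with h2x | h2y
    · exact exists_smaller_of_even hxy hzx.symm hyz h2x hS h
    · rw [show x + y + z = y + z + x by ring] at *
      exact exists_smaller_of_even hyz hxy.symm hzx h2y hS (by linear_combination h)
  · rw [show x + y + z = z + x + y by ring] at *
    exact exists_smaller_of_even hzx hyz.symm hxy h2z hS (by linear_combination h)

theorem add_add_eq_zero_of_int (x y z : ℤ) (h : 2 * (x + y + z) ^ 3 = 81 * (x * y * z)) :
    x + y + z = 0 := by
  by_contra hS
  induction hn : (x + y + z).natAbs using Nat.strong_induction_on generalizing x y z with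
  | _ n ih =>
  subst hn
  by_cases hg : ∀ p : ℤ, Prime p → p ∣ x → p ∣ y → p ∣ z → False
  · obtain ⟨x', y', z', hS', h', hlt⟩ := exists_smaller hg hS h
    exact ih _ hlt x' y' z' h' hS' rfl
  · push Not at hg
    obtain ⟨p, hp, ⟨x, rfl⟩, ⟨y, rfl⟩, ⟨z, rfl⟩, -⟩ := hg
    have hsum : p * x + p * y + p * z = p * (x + y + z) := by ring
    rw [hsum] at h hS ih
    have hS' : x + y + z ≠ 0 := right_ne_zero_of_mul hS
    refine ih _ ?_ x y z ?_ hS' rfl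
    · rw [Int.natAbs_mul]
      exact lt_mul_of_one_lt_left (Int.natAbs_pos.mpr hS') (Int.prime_iff_natAbs_prime.mp hp).one_lt
    · exact mul_left_cancel₀ (pow_ne_zero 3 hp.ne_zero) (by linear_combination h)

/-- The curve `2 (x + y + z)³ = 81 x y z` has no rational points outside the triangle `x y z = 0`. -/
theorem add_add_eq_zero_of_rat (x y z : ℚ) (h : 2 * (x + y + z) ^ 3 = 81 * (x * y * z)) :
    x + y + z = 0 := by
  have hx := Rat.mul_den_eq_num x
  have hy := Rat.mul_den_eq_num y
  have hz := Rat.mul_den_eq_num z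
  have hx0 : (x.den : ℚ) ≠ 0 := by exact_mod_cast x.den_nz
  have hy0 : (y.den : ℚ) ≠ 0 := by exact_mod_cast y.den_nz
  have hz0 : (z.den : ℚ) ≠ 0 := by exact_mod_cast z.den_nz
  have hI := add_add_eq_zero_of_int (x.num * y.den * z.den) (y.num * x.den * z.den)
    (z.num * x.den * y.den) (by
      have : ((2 * (x.num * y.den * z.den + y.num * x.den * z.den + z.num * x.den * y.den) ^ 3 : ℤ)
        : ℚ) = ((81 * ((x.num * y.den * z.den) * (y.num * x.den * z.den) *
          (z.num * x.den * y.den)) : ℤ) : ℚ) := by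
        push_cast
        rw [← hx, ← hy, ← hz]
        linear_combination (x.den * y.den * z.den : ℚ) ^ 3 * h
      exact_mod_cast this)
  have hQ : ((x.num * y.den * z.den + y.num * x.den * z.den + z.num * x.den * y.den : ℤ) : ℚ) = 0 :=
    by rw [hI]; simp
  push_cast at hQ
  rw [← hx, ← hy, ← hz] at hQ
  have : (x.den * y.den * z.den : ℚ) * (x + y + z) = 0 := by linear_combination hQ
  exact (mul_eq_zero.mp this).resolve_left (by positivity)

/-! ### Cubic factors and the curve `u^2 = v`. -/

theorem quadratic_eq_zero {R : Type*} [Semiring R] {e₂ e₁ e₀ : R}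
    (h : C e₂ * X ^ 2 + C e₁ * X + C e₀ = 0) : e₂ = 0 ∧ e₁ = 0 ∧ e₀ = 0 := by
  have h2 := congrArg (coeff · 2) h
  have h1 := congrArg (coeff · 1) h
  have h0 := congrArg (coeff · 0) h
  simp [coeff_X, coeff_C] at h0 h1 h2
  exact ⟨h2, h1, h0⟩

/-- If `α` is a root of a rational cubic and `α³` is a root of a rational cubic `h` without rational
roots, then `h` is the characteristic polynomial of `α³`. -/
theorem coeffs_eq_of_cube_root {K : Type*} [Field K] [Algebra ℚ K] {a b c u v w : ℚ} {α : K}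
    (hα : α ^ 3 + algebraMap ℚ K a * α ^ 2 + algebraMap ℚ K b * α + algebraMap ℚ K c = 0)
    (hβ : (α ^ 3) ^ 3 + algebraMap ℚ K u * (α ^ 3) ^ 2 + algebraMap ℚ K v * α ^ 3 +
      algebraMap ℚ K w = 0)
    (hroot : ∀ t : ℚ, t ^ 3 + u * t ^ 2 + v * t + w ≠ 0) :
    u = a ^ 3 - 3 * a * b + 3 * c ∧ v = b ^ 3 - 3 * a * b * c + 3 * c ^ 2 ∧ w = c ^ 3 := by
  set h : ℚ[X] := X ^ 3 + C u * X ^ 2 + C v * X + C w with hh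
  have hcubic : h = C 1 * X ^ 3 + C u * X ^ 2 + C v * X + C w := by rw [hh]; simp
  have hdeg : h.natDegree = 3 := by rw [hcubic]; exact natDegree_cubic one_ne_zero
  have hmonic : h.Monic := by
    rw [Monic, hcubic]; exact leadingCoeff_cubic one_ne_zero
  have hirr : Irreducible h := by
    rw [irreducible_iff_roots_eq_zero_of_degree_le_three (by omega) (by omega),
      Multiset.eq_zero_iff_forall_notMem]
    intro t ht
    rw [mem_roots hmonic.ne_zero, IsRoot.def] at ht
    exact hroot t (by simpa [hh] using ht)
  have hmin : h = minpoly ℚ (α ^ 3) :=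
    minpoly.eq_of_irreducible_of_monic hirr (by simpa [hh] using hβ) hmonic
  set d : ℚ[X] := C (u - (a ^ 3 - 3 * a * b + 3 * c)) * X ^ 2 +
    C (v - (b ^ 3 - 3 * a * b * c + 3 * c ^ 2)) * X + C (w - c ^ 3) with hd
  have hd0 : d = 0 := by
    by_contra hne
    have haeval : aeval (α ^ 3) d = 0 := by
      simp only [hd, map_add, map_mul, map_pow, map_sub, aeval_C, aeval_X, map_ofNat]
      generalize algebraMap ℚ K a = a' at *
      generalize algebraMap ℚ K b = b' at *
      generalize algebraMap ℚ K c = c' at *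
      -- With `X = α^3 + c`, `Y = bα`, `Z = aα^2`, the relation `X + Y + Z = 0` gives `X^3 + Y^3 +
      -- Z^3 - 3XYZ = 0`, a monic cubic in `α^3`.
      linear_combination hβ - ((α ^ 3 + c') ^ 2 + (b' * α) ^ 2 + (a' * α ^ 2) ^ 2 -
        (α ^ 3 + c') * (b' * α) - (b' * α) * (a' * α ^ 2) - (α ^ 3 + c') * (a' * α ^ 2)) * hα
    have hle := natDegree_le_natDegree (minpoly.degree_le_of_ne_zero ℚ (α ^ 3) hne haeval)
    rw [← hmin, hdeg] at hle
    have := hle.trans (natDegree_quadratic_le (R := ℚ))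
    omega
  obtain ⟨h2, h1, h0⟩ := quadratic_eq_zero hd0
  exact ⟨by linarith, by linarith, by linarith⟩

/-- Rational solutions of `u² = v`, where `u` and `v` are the middle coefficients of the
characteristic polynomial of the cube of a root of `x³ + a x² + b x + c`. -/
theorem cubic_coeffs {a b c : ℚ} (hc : c ≠ 0)
    (h : (a ^ 3 - 3 * a * b + 3 * c) ^ 2 = b ^ 3 - 3 * a * b * c + 3 * c ^ 2)
    (hne : c ≠ a ^ 3 - 3 * a * b + 3 * c) :
    (∃ l : ℚ, l ≠ 0 ∧ a = 2 * l ∧ b = 4 * l ^ 2 ∧ c = 4 * l ^ 3) ∨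
      ∃ l : ℚ, l ≠ 0 ∧ a = 0 ∧ b = 6 * l ^ 2 ∧ c = 6 * l ^ 3 := by
  by_cases ha : a = 0
  · subst ha
    right
    have hb3 : b ^ 3 = 6 * c ^ 2 := by linarith
    have hb : b ≠ 0 := by
      rintro rfl; apply hc; simpa using hb3.symm
    refine ⟨c / b, div_ne_zero hc hb, rfl, ?_, ?_⟩
    · field_simp; linarith
    · field_simp; linarith
  · left
    have hkey : (b - a ^ 2) ^ 3 = 3 * (2 * c - a * b) * (c - 2 * a * b + a ^ 3) := by
      linear_combination -h
    -- These three entries sum to `3a(b - a^2)`.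
    have hsum := add_add_eq_zero_of_rat (-a ^ 3) (2 * c - a * b) (-2 * (c - 2 * a * b + a ^ 3))
      (by linear_combination 54 * a ^ 3 * hkey)
    have hb : b = a ^ 2 := by
      have : 3 * a * (b - a ^ 2) = 0 := by linear_combination hsum
      have := (mul_eq_zero.mp this).resolve_left (by positivity)
      linarith
    subst hb
    have hprod : (2 * c - a ^ 3) * (c - a ^ 3) = 0 := by linear_combination -hkey / 3
    rcases mul_eq_zero.mp hprod with h0 | h0
    · exact ⟨a / 2, by positivity, by ring, by ring, by linarith⟩
    -- Here `c = a^3` makes `u = c`, which in the application means `A = 0`.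
    · exact absurd (by linarith) hne

theorem theorem6p4 :
    (∀ A B r : ℚ, A ≠ 0 → B ≠ 0 →
      (ratTrinomial 4 1 A B).IsRoot r →
      (∃ g : ℚ[X], g.natDegree = 3 ∧ g ∣ ratTrinomial 12 3 A B / (X ^ 3 - C r)) →
      (∃ w : ℚ, r * w * (r - w) ≠ 0 ∧
          A = -((r - w) * (r ^ 2 + w ^ 2)) ∧
          B = -(r * w * (r ^ 2 - r * w + w ^ 2)) ∧
          ratTrinomial 12 3 A B =
            (X ^ 3 - C r) * (X ^ 3 + C w) *
              (X ^ 6 + C (r - w) * X ^ 3 + C (r ^ 2 - r * w + w ^ 2))) ∨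
        EqUpToScaling 12 3 A B 128 256 ∨
        EqUpToScaling 12 3 A B (-5616) (-3888)) ∧
    ratTrinomial 12 3 128 256 =
      (X ^ 3 + 4) * (X ^ 3 + 2 * X ^ 2 + 4 * X + 4) *
        (X ^ 6 - 2 * X ^ 5 + 8 * X ^ 2 - 16 * X + 16) ∧
    ratTrinomial 12 3 (-5616) (-3888) =
      (X ^ 3 - 18) * (X ^ 3 + 6 * X + 6) *
        (X ^ 6 - 6 * X ^ 4 + 12 * X ^ 3 + 36 * X ^ 2 - 36 * X + 36) := by
  refine ⟨?_, ?_, ?_⟩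
  · rintro A B r hA hB hr ⟨g, hg3, hg⟩
    have hr' : r ^ 4 + A * r + B = 0 := by simpa [ratTrinomial, IsRoot.def] using hr
    have hBr : B = -(r * (r ^ 3 + A)) := by linarith
    have hr0 : r ≠ 0 := by rintro rfl; apply hB; simpa using hBr
    have hc0 : r ^ 3 + A ≠ 0 := by intro h0; apply hB; rw [hBr, h0]; ring
    by_cases hroot : ∃ t : ℚ, t ^ 3 + r * t ^ 2 + r ^ 2 * t + (r ^ 3 + A) = 0
    · left
      obtain ⟨t, ht⟩ := hroot
      have hAt : A = -((r - -t) * (r ^ 2 + (-t) ^ 2)) := by linear_combination ht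
      have hBt : B = -(r * -t * (r ^ 2 - r * -t + (-t) ^ 2)) := by
        rw [hBr]; linear_combination -r * ht
      refine ⟨-t, ?_, hAt, hBt, ?_⟩
      · refine mul_ne_zero (mul_ne_zero hr0 ?_) ?_
        · intro h0; apply hB; rw [hBt, h0]; ring
        · intro h0; apply hA; rw [hAt, h0]; ring
      · rw [hAt, hBt, ratTrinomial]
        simp only [map_neg, map_mul, map_sub, map_add, map_pow]
        ring
    · right
      push Not at hroot
      have hquot : ratTrinomial 12 3 A B / (X ^ 3 - C r) =
          (X ^ 3) ^ 3 + C r * (X ^ 3) ^ 2 + C (r ^ 2) * X ^ 3 + C (r ^ 3 + A) := by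
        have : ratTrinomial 12 3 A B = (X ^ 3 - C r) *
            ((X ^ 3) ^ 3 + C r * (X ^ 3) ^ 2 + C (r ^ 2) * X ^ 3 + C (r ^ 3 + A)) := by
          rw [ratTrinomial, hBr]
          simp only [map_neg, map_mul, map_add, map_pow]
          ring
        rw [this, mul_div_cancel_left₀ _ (X_pow_sub_C_ne_zero (by norm_num) r)]
      rw [hquot] at hg
      obtain ⟨α, hα⟩ := IsAlgClosed.exists_aeval_eq_zero (AlgebraicClosure ℚ) g
        (fun h0 => by simp [natDegree, h0] at hg3)
      have hβ := aeval_eq_zero_of_dvd_aeval_eq_zero hg hα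
      have hlead : g.coeff 3 ≠ 0 := by
        rw [← hg3]; exact leadingCoeff_ne_zero.mpr (by rintro rfl; simp at hg3)
      have hlead' : algebraMap ℚ (AlgebraicClosure ℚ) (g.coeff 3) ≠ 0 := by simpa using hlead
      rw [aeval_eq_sum_range, hg3] at hα
      simp only [Finset.sum_range_succ, Finset.sum_range_zero, Algebra.smul_def] at hα
      obtain ⟨h1, h2, h3⟩ := coeffs_eq_of_cube_root (a := g.coeff 2 / g.coeff 3)
        (b := g.coeff 1 / g.coeff 3) (c := g.coeff 0 / g.coeff 3) (α := α)
        (by simp only [map_div₀]; field_simp; linear_combination hα) (by simpa using hβ) hroot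
      generalize g.coeff 2 / g.coeff 3 = a at *
      generalize g.coeff 1 / g.coeff 3 = b at *
      generalize g.coeff 0 / g.coeff 3 = c at *
      have hAc : A = c ^ 3 - r ^ 3 := by linarith
      rcases cubic_coeffs (a := a) (b := b) (c := c)
        (by rintro rfl; apply hc0; rw [h3]; ring) (by rw [← h1, h2])
        (by rw [← h1]; rintro rfl; apply hA; rw [hAc]; ring) with
        ⟨l, hl, rfl, rfl, rfl⟩ | ⟨l, hl, rfl, rfl, rfl⟩
      · left
        refine ⟨l, hl, ?_, ?_⟩
        · rw [hAc, h1]; ring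
        · rw [hBr, h3, h1]; ring
      · right
        refine ⟨l, hl, ?_, ?_⟩
        · rw [hAc, h1]; ring
        · rw [hBr, h3, h1]; ring
  · have h1 : (C 128 : ℚ[X]) = 128 := rfl
    have h2 : (C 256 : ℚ[X]) = 256 := rfl
    rw [ratTrinomial, h1, h2]
    ring
  · have h1 : (C (-5616) : ℚ[X]) = -5616 := by rw [map_neg]; rfl
    have h2 : (C (-3888) : ℚ[X]) = -3888 := by rw [map_neg]; rfl
    rw [ratTrinomial, h1, h2]
    ring
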